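/- Let $m,n,k$ be positive integers with $k\le\min\{m,n\}$, let $2\le p<\infty$ and $\varepsilon\in[0,1)$, and let $A,B$ be complex $m\times n$ matrices. Write $\sigma_1(X)\ge\sigma_2(X)\ge\cdots\ge\sigma_{\min\{m,n\}}(X)$ for the singular values of an $m\times n$ matrix $X$, and let $\|X\|_{(p,k)}=\big(\sum_{i=1}^{k}\sigma_i(X)^p\big)^{1/p}$ be its Ky Fan $p$-$k$ norm. Say that $A$ is $\varepsilon$-Birkhoff orthogonal to $B$ in this norm if $$\|A+\lambda B\|_{(p,k)}^2\ \ge\ \|A\|_{(p,k)}^2-2\varepsilon\,\|A\|_{(p,k)}\,\|\lambda B\|_{(p,k)}\qquad\text{for all }\lambda\in\mathbb C .$$ Then $A$ is $\varepsilon$-Birkhoff orthogonal to $B$ in the norm $\|\cdot\|_{(p,k)}$ if and only if there exist $k$ orthonormal vectors $v_1,\dots,v_k\in\mathbb C^n$ with $A^*Av_i=\sigma_i(A)^2v_i$ for all $1\le i\le k$, and a number $z_0\in\mathbb C$ with $|z_0|\le 1$, such that $$\frac{1}{\|A\|_{(p,k)}^{p-1}}\sum_{i=1}^{k}\big\langle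 (A^*A)^{\frac{p-2}{2}}A^*Bv_i,\,v_i\big\rangle+z_0\,\varepsilon\,\|B\|_{(p,k)}=0 .$$ Here $\langle\cdot,\cdot\rangle$ is the standard inner product of $\mathbb C^n$, linear in its first argument, $(A^*A)^0=I$, and for $A=0$ the first term is read as $0$. -/

import Mathlib

/-- `singularValue A i` is the `(i + 1)`-st singular value of the complex `m × n` matrix `A`: the
singular values are arranged in non-increasing order, and the index starts at `0`. -/
noncomputable def singularValue {m n : ℕ} (A : Matrix (Fin m) (Fin n) ℂ) (i : ℕ) : ℝ :=
  (Matrix.toEuclideanLin A).singularValues i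

/-- The Ky Fan `p`-`k` norm: the `ℓ_p` norm of the vector of the `k` largest singular values. -/
noncomputable def kyFanNorm (p : ℝ) (k : ℕ) {m n : ℕ} (A : Matrix (Fin m) (Fin n) ℂ) : ℝ :=
  (∑ i ∈ Finset.range k, singularValue A i ^ p) ^ (1 / p)

/-- `A` is `ε`-Birkhoff orthogonal to `B` with respect to the norm `N`. -/
def EpsBirkhoffOrthogonal {E : Type*} [AddCommGroup E] [Module ℂ E] (N : E → ℝ) (ε : ℝ)
    (A B : E) : Prop :=
  ∀ z : ℂ, N A ^ 2 - 2 * ε * N A * N (z • B) ≤ N (A + z • B) ^ 2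

/-- The power `(A* A) ^ s` of the positive semidefinite matrix `A* A`, in the sense of the
functional calculus (so that it is the identity matrix for `s = 0`). -/
noncomputable def gramPow {m n : ℕ} (A : Matrix (Fin m) (Fin n) ℂ) (s : ℝ) :
    Matrix (Fin n) (Fin n) ℂ :=
  cfc (fun x : ℝ => x ^ s) (A.conjTranspose * A)

/-! By Ky Fan's principle and the convexity of `x ^ (p / 2)`, the p-th power of the norm of T is the
maximum of ∑ ‖T vᵢ‖ ^ p over orthonormal k-tuples, attained at top frames
(`sum_norm_sq_rpow_le_sum_singularValues`). Each top frame v gives the functional S ↦ ∑ σᵢ ^ (p - 2)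
⟨T vᵢ, S vᵢ⟩, bounded by ‖T‖ ^ (p - 1) ‖S‖ (Hölder), with equality at S = T. Evaluating it at T + z
S gives sufficiency.

For necessity, let W be the set of values of these functionals at S. Differentiating the norm along
T + t w S, |w| = 1, and passing to a limit of top frames as t → 0 gives c ∈ W with Re (w c) ≥ -r,
where r = ε ‖T‖ ^ (p - 1) ‖S‖ (`exists_isTopFrame_of_kyFanNorm_rpow_ge`). Since W is compact and
convex, its point of least norm has modulus at most r, and z₀ is obtained by division.

Convexity of W is the crux (`convex_setOf_sum_inner_isTopFrame`). Top frames differ in value only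
through the eigenspace of σₖ², where the values form a higher numerical range. That range is convex
because an operator 0 ≤ X ≤ 1 of trace N, a natural number, can be replaced by a projection with the
same trace and the same tr (M X): a maximiser of the Hilbert–Schmidt norm under these constraints
has no fractional eigenvalue. -/

/-! ### Scalar inequalities -/

/-- Rearrangement bound: weights in `[0, 1]` of total mass `k` pick up at most the `k` first terms
of a non-increasing sequence. -/
theorem sum_mul_le_sum_range_of_antitone {k n : ℕ} (hkn : k ≤ n) {μ : ℕ → ℝ} (hμ : Antitone μ)
    {s : Fin n → ℝ} (hs0 : ∀ j, 0 ≤ s j) (hs1 : ∀ j, s j ≤ 1) (hs : ∑ j, s j = k) :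
    ∑ j : Fin n, μ j * s j ≤ ∑ j ∈ Finset.range k, μ j := by
  -- Subtracting the threshold `μ k` leaves at most the positive part of `μ j - μ k`; the total mass
  -- `k` restores what was subtracted.
  have h1 : ∀ j : Fin n,
      μ j * s j ≤ μ k * s j + (fun j : ℕ => if j < k then μ j - μ k else 0) j := by
    intro j
    dsimp only
    split_ifs with h
    · nlinarith [hμ h.le, hs0 j, hs1 j]
    · nlinarith [hμ (not_lt.mp h), hs0 j]
  refine (Finset.sum_le_sum fun j _ => h1 j).trans ?_
  rw [Finset.sum_add_distrib, ← Finset.mul_sum, hs,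
    Fin.sum_univ_eq_sum_range (fun j : ℕ => if j < k then μ j - μ k else 0) n,
    ← Finset.sum_filter]
  have : (Finset.range n).filter (· < k) = Finset.range k := by
    ext j
    simp only [Finset.mem_filter, Finset.mem_range]
    omega
  rw [this, Finset.sum_sub_distrib]
  simp only [Finset.sum_const, Finset.card_range, nsmul_eq_mul]
  linarith

/-- The tangent line inequality for the convex function `x ↦ x ^ q` on `[0, ∞)`. -/
theorem rpow_sub_rpow_le {q : ℝ} (hq : 1 ≤ q) {x y : ℝ} (hx : 0 ≤ x) (hy : 0 ≤ y) :
    y ^ q - x ^ q ≤ q * y ^ (q - 1) * (y - x) := by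
  -- At y = 0 the slope factor is `0 ^ (q - 1)`, which is 1 when q = 1. For y > 0 the claim is
  -- Bernoulli's inequality at x / y - 1, scaled by `y ^ q`.
  rcases hy.eq_or_lt with rfl | hy'
  · rcases hq.eq_or_lt with rfl | hq'
    · simp
    · rw [Real.zero_rpow (by linarith), Real.zero_rpow (by linarith)]
      have := Real.rpow_nonneg hx q
      simpa using this
  · have h := one_add_mul_self_le_rpow_one_add (s := x / y - 1)
      (by linarith [div_nonneg hx hy]) hq
    rw [add_sub_cancel, Real.div_rpow hx hy] at h
    have hyq : 0 < y ^ q := Real.rpow_pos_of_pos hy' q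
    rw [le_div_iff₀ hyq] at h
    have e : y ^ (q - 1) = y ^ q / y := Real.rpow_sub_one hy'.ne' q
    rw [e]
    have e2 : q * (y ^ q / y) * (y - x) = y ^ q - (1 + q * (x / y - 1)) * y ^ q := by
      field_simp
      ring
    rw [e2]
    linarith

/-! ### Top frames and Ky Fan's maximum principle -/

section Frames

open Module

variable {E F : Type*} [NormedAddCommGroup E] [InnerProductSpace ℂ E] [FiniteDimensional ℂ E]
  [NormedAddCommGroup F] [InnerProductSpace ℂ F] [FiniteDimensional ℂ F]

/-- An orthonormal family of eigenvectors of `T* T` for the `k` largest eigenvalues, in order. -/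
def IsTopFrame (T : E →ₗ[ℂ] F) {k : ℕ} (v : Fin k → E) : Prop :=
  Orthonormal ℂ v ∧
    ∀ i : Fin k, LinearMap.adjoint T (T (v i)) = ((T.singularValues i ^ 2 : ℝ) : ℂ) • v i

/-- The eigenbasis of `T* T`, ordered by non-increasing eigenvalues. -/
theorem exists_rightSingularBasis (T : E →ₗ[ℂ] F) :
    ∃ u : OrthonormalBasis (Fin (finrank ℂ E)) ℂ E,
      ∀ j, LinearMap.adjoint T (T (u j)) = ((T.singularValues j ^ 2 : ℝ) : ℂ) • u j := by
  refine ⟨T.isSymmetric_adjoint_comp_self.eigenvectorBasis rfl, fun j => ?_⟩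
  rw [T.sq_singularValues_fin rfl j]
  exact T.isSymmetric_adjoint_comp_self.apply_eigenvectorBasis rfl j

theorem exists_isTopFrame (T : E →ₗ[ℂ] F) {k : ℕ} (hk : k ≤ finrank ℂ E) :
    ∃ v : Fin k → E, IsTopFrame T v := by
  obtain ⟨u, hu⟩ := exists_rightSingularBasis T
  exact ⟨fun i => u (Fin.castLE hk i),
    u.orthonormal.comp _ (Fin.castLE_injective hk), fun i => hu (Fin.castLE hk i)⟩

theorem inner_self_eq_ofReal_norm_sq {G : Type*} [NormedAddCommGroup G] [InnerProductSpace ℂ G]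
    (x : G) : inner ℂ x x = ((‖x‖ ^ 2 : ℝ) : ℂ) := by
  rw [inner_self_eq_norm_sq_to_K]
  simp

theorem IsTopFrame.norm_sq_apply {T : E →ₗ[ℂ] F} {k : ℕ} {v : Fin k → E} (hv : IsTopFrame T v)
    (i : Fin k) : ‖T (v i)‖ ^ 2 = T.singularValues i ^ 2 := by
  have h : inner ℂ (T (v i)) (T (v i)) = ((T.singularValues i ^ 2 : ℝ) : ℂ) := by
    rw [← LinearMap.adjoint_inner_right, hv.2 i, inner_smul_right,
      inner_self_eq_ofReal_norm_sq, hv.1.1 i]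
    simp
  rw [inner_self_eq_ofReal_norm_sq] at h
  exact_mod_cast h

theorem IsTopFrame.norm_apply {T : E →ₗ[ℂ] F} {k : ℕ} {v : Fin k → E} (hv : IsTopFrame T v)
    (i : Fin k) : ‖T (v i)‖ = T.singularValues i :=
  (sq_eq_sq₀ (norm_nonneg _) (T.singularValues_nonneg i)).1 (hv.norm_sq_apply i)

/-- Parseval in the eigenbasis. For a unit vector the right side is a convex combination, ready for
Jensen. -/
theorem norm_sq_apply_eq_sum {T : E →ₗ[ℂ] F} {u : OrthonormalBasis (Fin (finrank ℂ E)) ℂ E}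
    (hu : ∀ j, LinearMap.adjoint T (T (u j)) = ((T.singularValues j ^ 2 : ℝ) : ℂ) • u j) (x : E) :
    ‖T x‖ ^ 2 = ∑ j, ‖inner ℂ (u j) x‖ ^ 2 * T.singularValues j ^ 2 := by
  have h : inner ℂ (T x) (T x) =
      ((∑ j, ‖inner ℂ (u j) x‖ ^ 2 * T.singularValues j ^ 2 : ℝ) : ℂ) := by
    rw [← LinearMap.adjoint_inner_right, ← u.sum_inner_mul_inner]
    push_cast
    refine Finset.sum_congr rfl fun j _ => ?_
    rw [LinearMap.adjoint_inner_right, ← LinearMap.adjoint_inner_left, hu,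
      inner_smul_left, Complex.conj_ofReal,
      ← inner_conj_symm x (u j), mul_left_comm, ← Complex.normSq_eq_conj_mul_self,
      Complex.normSq_eq_norm_sq]
    push_cast
    ring
  rw [inner_self_eq_ofReal_norm_sq] at h
  exact_mod_cast h

/-- Ky Fan's maximum principle, for convex powers of the singular values. -/
theorem sum_norm_sq_rpow_le_sum_singularValues (T : E →ₗ[ℂ] F) {q : ℝ} (hq : 1 ≤ q) {k : ℕ}
    {v : Fin k → E} (hv : Orthonormal ℂ v) :
    ∑ i, (‖T (v i)‖ ^ 2) ^ q ≤ ∑ j ∈ Finset.range k, (T.singularValues j ^ 2) ^ q := by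
  obtain ⟨u, hu⟩ := exists_rightSingularBasis T
  have hkn : k ≤ finrank ℂ E := by
    simpa using hv.linearIndependent.fintype_card_le_finrank
  have hw : ∀ i, ∑ j, ‖inner ℂ (u j) (v i)‖ ^ 2 = 1 := fun i => by
    rw [u.sum_sq_norm_inner_right, hv.1 i, one_pow]
  have h1 : ∀ i, (‖T (v i)‖ ^ 2) ^ q ≤
      ∑ j, ‖inner ℂ (u j) (v i)‖ ^ 2 * (T.singularValues j ^ 2) ^ q := fun i => by
    rw [norm_sq_apply_eq_sum hu]
    exact Real.rpow_arith_mean_le_arith_mean_rpow _ _ _ (fun _ _ => by positivity) (hw i)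
      (fun _ _ => by positivity) hq
  refine (Finset.sum_le_sum fun i _ => h1 i).trans ?_
  rw [Finset.sum_comm]
  simp_rw [← Finset.sum_mul, mul_comm _ ((_ : ℝ) ^ q)]
  refine sum_mul_le_sum_range_of_antitone hkn
    (μ := fun j => (T.singularValues j ^ 2) ^ q) (fun a b hab => ?_)
    (fun j => by positivity) (fun j => ?_) ?_
  · have := T.singularValues_antitone hab
    have h0 := T.singularValues_nonneg b
    dsimp only
    gcongr
  -- Bessel for `v`, tested on `u j`, bounds each column sum of the weights by 1; the row sums are 1
  -- by Parseval, so the total mass is `k`.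
  · have := hv.sum_inner_products_le (s := Finset.univ) (u j)
    rw [u.orthonormal.1 j, one_pow] at this
    refine le_trans (le_of_eq (Finset.sum_congr rfl fun i _ => ?_)) this
    rw [norm_inner_symm]
  · rw [Finset.sum_comm]
    simp [hw]

end Frames

/-! ### Trace-preserving perturbations -/

section NumericalRange

open Module InnerProductSpace

variable {E : Type*} [NormedAddCommGroup E] [InnerProductSpace ℂ E] [FiniteDimensional ℂ E]

/-- If numbers in `[0, 1]` have an integer sum and one of them is fractional, then another one is. -/
theorem exists_ne_fractional {ι : Type*} [Fintype ι] {μ : ι → ℝ} (h0 : ∀ j, 0 ≤ μ j)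
    (h1 : ∀ j, μ j ≤ 1) {N : ℕ} (hN : ∑ j, μ j = N) {a : ι} (ha : 0 < μ a ∧ μ a < 1) :
    ∃ b, b ≠ a ∧ 0 < μ b ∧ μ b < 1 := by
  classical
  by_contra! h
  have hb : ∀ b ∈ Finset.univ.erase a, μ b = if 0 < μ b then 1 else 0 := fun b hb => by
    split_ifs with hp
    · exact le_antisymm (h1 b) (h b (Finset.ne_of_mem_erase hb) hp)
    · exact le_antisymm (not_lt.mp hp) (h0 b)
  rw [← Finset.add_sum_erase _ _ (Finset.mem_univ a), Finset.sum_congr rfl hb, Finset.sum_boole]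
    at hN
  -- With `a` the only fractional index, `N` would lie strictly between `c` and `c + 1`.
  set c := ((Finset.univ.erase a).filter fun b => 0 < μ b).card
  have h2 : (c : ℝ) < N := by linarith
  have h3 : (N : ℝ) < c + 1 := by linarith
  norm_cast at h2 h3
  omega

/-- The trace of `T ∘ X`, as a linear functional of the operator `X`. -/
noncomputable def traceMul (T : E →L[ℂ] E) : (E →L[ℂ] E) →ₗ[ℂ] ℂ where
  toFun X := LinearMap.trace ℂ E (T ∘L X : E →L[ℂ] E)
  map_add' X Y := by
    rw [ContinuousLinearMap.comp_add, ContinuousLinearMap.toLinearMap_add, map_add]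
  map_smul' c X := by
    rw [ContinuousLinearMap.comp_smul, ContinuousLinearMap.toLinearMap_smul, map_smul,
      RingHom.id_apply]

theorem traceMul_rankOne (T : E →L[ℂ] E) (x y : E) :
    traceMul T (rankOne ℂ x y) = inner ℂ y (T x) := by
  change LinearMap.trace ℂ E (T ∘L rankOne ℂ x y : E →L[ℂ] E) = _
  rw [comp_rankOne, trace_rankOne]

omit [FiniteDimensional ℂ E] in
theorem traceMul_eq_sum {ι : Type*} [Fintype ι] (e : OrthonormalBasis ι ℂ E) (T X : E →L[ℂ] E) :
    traceMul T X = ∑ j, inner ℂ (e j) (T (X (e j))) :=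
  LinearMap.trace_eq_sum_inner _ e

theorem continuous_traceMul (T : E →L[ℂ] E) : Continuous (traceMul T) :=
  (traceMul T).continuous_of_finiteDimensional

section Diagonal

variable {ι : Type*} [Fintype ι] {e : OrthonormalBasis ι ℂ E} {X : E →L[ℂ] E} {μ : ι → ℝ}

omit [FiniteDimensional ℂ E] in
theorem re_inner_apply_self_of_diagonal (hX : ∀ j, X (e j) = (μ j : ℂ) • e j) (x : E) :
    RCLike.re (inner ℂ (X x) x) = ∑ j, μ j * ‖inner ℂ (e j) x‖ ^ 2 := by
  have h : inner ℂ (X x) x = ((∑ j, μ j * ‖inner ℂ (e j) x‖ ^ 2 : ℝ) : ℂ) := by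
    conv_lhs => rw [← e.sum_repr' x]
    rw [map_sum, sum_inner]
    push_cast
    refine Finset.sum_congr rfl fun j _ => ?_
    rw [map_smul, hX, inner_smul_left, inner_smul_left, e.sum_repr' x, Complex.conj_ofReal,
      mul_left_comm, ← Complex.normSq_eq_conj_mul_self, Complex.normSq_eq_norm_sq]
    push_cast
    ring
  rw [h]
  exact RCLike.ofReal_re (K := ℂ) _

-- The eigenvalues at `a` and `b`, both at least `m`, absorb the form of `D`. Used for `X` and for
-- `1 - X`, so that both order bounds survive.
omit [FiniteDimensional ℂ E] in
theorem nonneg_add_of_diagonal (hXs : (X : E →ₗ[ℂ] E).IsSymmetric)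
    (hX : ∀ j, X (e j) = (μ j : ℂ) • e j) (hμ : ∀ j, 0 ≤ μ j) {a b : ι} (hab : a ≠ b) {m : ℝ}
    (hma : m ≤ μ a) (hmb : m ≤ μ b) {D : E →L[ℂ] E} (hDs : (D : E →ₗ[ℂ] E).IsSymmetric)
    (hD : ∀ x, |RCLike.re (inner ℂ (D x) x)| ≤
      m * (‖inner ℂ (e a) x‖ ^ 2 + ‖inner ℂ (e b) x‖ ^ 2)) : 0 ≤ X + D := by
  classical
  rw [ContinuousLinearMap.nonneg_iff_isPositive]
  refine ⟨hXs.add hDs, fun x => ?_⟩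
  rw [ContinuousLinearMap.reApplyInnerSelf_apply, add_apply, inner_add_left,
    map_add, re_inner_apply_self_of_diagonal hX]
  have h1 : μ a * ‖inner ℂ (e a) x‖ ^ 2 + μ b * ‖inner ℂ (e b) x‖ ^ 2 ≤
      ∑ j, μ j * ‖inner ℂ (e j) x‖ ^ 2 := by
    rw [← Finset.sum_pair (f := fun j => μ j * ‖inner ℂ (e j) x‖ ^ 2) hab]
    exact Finset.sum_le_sum_of_subset_of_nonneg (Finset.subset_univ _)
      fun j _ _ => mul_nonneg (hμ j) (by positivity)
  have h2 := (abs_le.1 (hD x)).1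
  nlinarith [sq_nonneg ‖inner ℂ (e a) x‖, sq_nonneg ‖inner ℂ (e b) x‖]

end Diagonal

omit [FiniteDimensional ℂ E] in
theorem isSymmetric_rankOne_add_rankOne (x y : E) (γ : ℂ) :
    ((γ • rankOne ℂ x y + (starRingEnd ℂ) γ • rankOne ℂ y x : E →L[ℂ] E) :
      E →ₗ[ℂ] E).IsSymmetric := by
  intro u v
  simp only [ContinuousLinearMap.coe_coe, add_apply,
    smul_apply, rankOne_apply, inner_add_left, inner_add_right,
    inner_smul_left, inner_smul_right, inner_conj_symm, Complex.conj_conj]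
  ring

/-- Self-adjoint perturbations supported on a plane that leave two traces unchanged. -/
theorem exists_perturbation (T : E →L[ℂ] E) {a b : E} (ha : ‖a‖ = 1) (hb : ‖b‖ = 1)
    (hab : inner ℂ a b = 0) :
    ∃ D : E →L[ℂ] E, D ≠ 0 ∧ (D : E →ₗ[ℂ] E).IsSymmetric ∧
      traceMul (ContinuousLinearMap.id ℂ E) D = 0 ∧
      traceMul T D = 0 ∧ ∃ C > 0, ∀ x, |RCLike.re (inner ℂ (D x) x)| ≤
        C * (‖inner ℂ a x‖ ^ 2 + ‖inner ℂ b x‖ ^ 2) := by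
  let Φ : (ℝ × ℂ) →ₗ[ℝ] (E →L[ℂ] E) :=
    { toFun := fun y => (y.1 : ℂ) • (rankOne ℂ a a - rankOne ℂ b b) +
        (y.2 • rankOne ℂ a b + (starRingEnd ℂ) y.2 • rankOne ℂ b a)
      map_add' := fun y z => by
        simp only [Prod.fst_add, Prod.snd_add, map_add, Complex.ofReal_add, add_smul]
        abel
      map_smul' := fun r y => by
        simp only [Prod.smul_fst, Prod.smul_snd, Complex.real_smul, smul_eq_mul, map_mul,
          Complex.conj_ofReal, Complex.ofReal_mul, mul_smul, RingHom.id_apply, smul_add]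
        rfl }
  have hba : inner ℂ b a = 0 := by rw [← inner_conj_symm, hab, map_zero]
  have haa : inner ℂ a a = 1 := by rw [inner_self_eq_ofReal_norm_sq, ha]; simp
  have hbb : inner ℂ b b = 1 := by rw [inner_self_eq_ofReal_norm_sq, hb]; simp
  -- Trace-free self-adjoint operators on the plane have real dimension 3, while tr (T D) = 0
  -- imposes only two real conditions.
  have hker : ((traceMul T).restrictScalars ℝ ∘ₗ Φ).ker ≠ ⊥ :=
    LinearMap.ker_ne_bot_of_finrank_lt (by simp [Complex.finrank_real_complex])
  obtain ⟨y, hy, hy0⟩ := (Submodule.ne_bot_iff _).1 hker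
  have hΦ : ∀ x, Φ y x = ((y.1 : ℂ) * inner ℂ a x + y.2 * inner ℂ b x) • a +
      ((starRingEnd ℂ) y.2 * inner ℂ a x - y.1 * inner ℂ b x) • b := fun x => by
    change ((y.1 : ℂ) • (rankOne ℂ a a - rankOne ℂ b b) +
        (y.2 • rankOne ℂ a b + (starRingEnd ℂ) y.2 • rankOne ℂ b a)) x = _
    simp only [add_apply, sub_apply,
      smul_apply, rankOne_apply]
    module
  refine ⟨Φ y, fun h => hy0 ?_, ?_, ?_, hy, |y.1| + ‖y.2‖, ?_, fun x => ?_⟩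
  · have h1 : inner ℂ a (Φ y a) = (y.1 : ℂ) := by
      rw [hΦ, inner_add_right, inner_smul_right, inner_smul_right, haa, hab, hba]; ring
    have h2 : inner ℂ a (Φ y b) = y.2 := by
      rw [hΦ, inner_add_right, inner_smul_right, inner_smul_right, haa, hab, hbb]; ring
    rw [h] at h1 h2
    simp only [zero_apply, inner_zero_right] at h1 h2
    exact Prod.ext (by exact_mod_cast h1.symm) h2.symm
  · have hs := isSymmetric_rankOne_add_rankOne a b y.2
    have h1 := isSymmetric_rankOne_self (𝕜 := ℂ) a
    have h2 := isSymmetric_rankOne_self (𝕜 := ℂ) b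
    exact ((h1.sub h2).smul (Complex.conj_ofReal y.1)).add hs
  · change traceMul _ ((y.1 : ℂ) • (rankOne ℂ a a - rankOne ℂ b b) +
        (y.2 • rankOne ℂ a b + (starRingEnd ℂ) y.2 • rankOne ℂ b a)) = 0
    simp only [map_add, map_sub, map_smul, traceMul_rankOne, ContinuousLinearMap.id_apply, haa,
      hbb, hab, hba]
    simp
  · rcases eq_or_ne y.1 0 with h | h
    · have : y.2 ≠ 0 := fun h2 => hy0 (Prod.ext h h2)
      positivity
    · positivity
  · have h1 : inner ℂ (Φ y x) x =
        (y.1 * ‖inner ℂ a x‖ ^ 2 - y.1 * ‖inner ℂ b x‖ ^ 2 : ℝ) +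
        ((starRingEnd ℂ) (y.2 * inner ℂ b x * (starRingEnd ℂ) (inner ℂ a x)) +
          y.2 * inner ℂ b x * (starRingEnd ℂ) (inner ℂ a x)) := by
      rw [hΦ, inner_add_left, inner_smul_left, inner_smul_left]
      push_cast
      rw [← Complex.ofReal_pow, ← Complex.ofReal_pow, ← Complex.normSq_eq_norm_sq,
        ← Complex.normSq_eq_norm_sq, Complex.normSq_eq_conj_mul_self,
        Complex.normSq_eq_conj_mul_self]
      simp only [map_add, map_sub, map_mul, Complex.conj_ofReal, Complex.conj_conj]
      ring
    have h2 := Complex.abs_re_le_norm (y.2 * inner ℂ b x * (starRingEnd ℂ) (inner ℂ a x))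
    rw [norm_mul, norm_mul, RCLike.norm_conj] at h2
    rw [h1]
    rw [RCLike.re_eq_complex_re]
    rw [Complex.add_re, Complex.add_re, Complex.conj_re, Complex.ofReal_re]
    set r := (y.2 * inner ℂ b x * (starRingEnd ℂ) (inner ℂ a x)).re
    set s := ‖inner ℂ a x‖
    set t := ‖inner ℂ b x‖
    have h3 : |y.1 * s ^ 2 - y.1 * t ^ 2| ≤ |y.1| * (s ^ 2 + t ^ 2) := by
      rw [← mul_sub, abs_mul]
      refine mul_le_mul_of_nonneg_left (abs_le.2 ⟨?_, ?_⟩) (abs_nonneg _) <;>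
        nlinarith [sq_nonneg s, sq_nonneg t]
    have h4 : |r + r| ≤ ‖y.2‖ * (s ^ 2 + t ^ 2) := by
      rw [← two_mul, abs_mul, abs_two]
      nlinarith [norm_nonneg y.2, mul_nonneg (norm_nonneg y.2) (sq_nonneg (s - t))]
    calc _ ≤ _ := abs_add_le _ _
      _ ≤ _ := add_le_add h3 h4
      _ = _ := by ring

end NumericalRange

/-! ### Convexity of the higher numerical range -/

section NumericalRangeConvexity

open Module InnerProductSpace

variable {E : Type*} [NormedAddCommGroup E] [InnerProductSpace ℂ E] [FiniteDimensional ℂ E]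

theorem isPositive_sum_rankOne {ι : Type*} [Fintype ι] (w : ι → E) :
    (0 : E →L[ℂ] E) ≤ ∑ i, rankOne ℂ (w i) (w i) :=
  Finset.sum_nonneg fun i _ =>
    (ContinuousLinearMap.nonneg_iff_isPositive _).2 (isPositive_rankOne_self (w i))

theorem sum_rankOne_le_one {ι : Type*} [Fintype ι] {w : ι → E} (hw : Orthonormal ℂ w) :
    ∑ i, rankOne ℂ (w i) (w i) ≤ (1 : E →L[ℂ] E) := by
  rw [ContinuousLinearMap.le_def]
  refine ⟨?_, fun x => ?_⟩
  · have h := ((ContinuousLinearMap.nonneg_iff_isPositive _).1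
      (isPositive_sum_rankOne w)).isSymmetric
    exact LinearMap.IsSymmetric.id.sub h
  · have h := hw.sum_inner_products_le (s := Finset.univ) x
    have e : inner ℂ ((∑ i, rankOne ℂ (w i) (w i) : E →L[ℂ] E) x) x =
        ((∑ i, ‖inner ℂ (w i) x‖ ^ 2 : ℝ) : ℂ) := by
      rw [sum_apply, sum_inner]
      push_cast
      refine Finset.sum_congr rfl fun i _ => ?_
      rw [rankOne_apply, inner_smul_left, ← Complex.normSq_eq_conj_mul_self,
        Complex.normSq_eq_norm_sq]
      push_cast
      rfl
    rw [ContinuousLinearMap.reApplyInnerSelf_apply, sub_apply, inner_sub_left, e,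
      one_apply_eq_self, inner_self_eq_ofReal_norm_sq, map_sub, RCLike.re_eq_complex_re,
      Complex.ofReal_re, Complex.ofReal_re]
    linarith

/-- The operators `0 ≤ X ≤ 1` with prescribed traces `tr X = N` and `tr (T X) = c`. -/
def traceFiber (T : E →L[ℂ] E) (N c : ℂ) : Set (E →L[ℂ] E) :=
  {X | X ∈ Set.Icc 0 1 ∧ traceMul (ContinuousLinearMap.id ℂ E) X = N ∧ traceMul T X = c}

theorem isCompact_traceFiber (T : E →L[ℂ] E) (N c : ℂ) : IsCompact (traceFiber T N c) := by
  have : ProperSpace (E →L[ℂ] E) := FiniteDimensional.proper ℂ _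
  have : CompleteSpace E := FiniteDimensional.complete ℂ E
  refine Metric.isCompact_of_isClosed_isBounded ?_ ?_
  · exact isClosed_Icc.inter ((isClosed_eq (continuous_traceMul _) continuous_const).inter
      (isClosed_eq (continuous_traceMul _) continuous_const))
  · refine (Metric.isBounded_closedBall (x := 0) (r := 1)).subset fun X hX => ?_
    rw [mem_closedBall_zero_iff]
    exact (CStarAlgebra.norm_le_one_iff_of_nonneg X hX.1.1).2 hX.1.2

theorem traceFiber_sum_rankOne (T : E →L[ℂ] E) {ι : Type*} [Fintype ι] {w : ι → E}
    (hw : Orthonormal ℂ w) :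
    ∑ i, rankOne ℂ (w i) (w i) ∈
      traceFiber T (Fintype.card ι) (∑ i, inner ℂ (w i) (T (w i))) := by
  refine ⟨⟨isPositive_sum_rankOne w, sum_rankOne_le_one hw⟩, ?_, ?_⟩
  · rw [map_sum]
    simp only [traceMul_rankOne, ContinuousLinearMap.id_apply, inner_self_eq_ofReal_norm_sq,
      hw.1]
    simp
  · rw [map_sum]
    simp only [traceMul_rankOne]

/-- A fractional eigenvalue forces a second one, as the trace is an integer. A perturbation on their
plane then keeps X ± t D in the fiber, and by the parallelogram law one of the two has larger
Hilbert–Schmidt norm. -/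
theorem eq_zero_or_one_of_maximal {ι : Type*} [Fintype ι] {T X : E →L[ℂ] E} {N : ℕ} {c : ℂ}
    (hX : X ∈ traceFiber T N c) {β : Type*} [Fintype β] {b : OrthonormalBasis β ℂ E}
    (hmax : IsMaxOn (fun Y : E →L[ℂ] E => ∑ j, ‖Y (b j)‖ ^ 2) (traceFiber T N c) X)
    {e : OrthonormalBasis ι ℂ E} {μ : ι → ℝ} (he : ∀ j, X (e j) = (μ j : ℂ) • e j)
    (hμ0 : ∀ j, 0 ≤ μ j) (hμ1 : ∀ j, μ j ≤ 1) (hμ : ∑ j, μ j = N) (a : ι) :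
    μ a = 0 ∨ μ a = 1 := by
  by_contra! hne
  have ha : 0 < μ a ∧ μ a < 1 := ⟨(hμ0 a).lt_of_ne' hne.1, (hμ1 a).lt_of_ne hne.2⟩
  obtain ⟨a', haa', ha'⟩ := exists_ne_fractional hμ0 hμ1 hμ ha
  obtain ⟨D, hD0, hDs, hD1, hDT, C, hC, hDC⟩ := exists_perturbation T (e.orthonormal.1 a)
    (e.orthonormal.1 a') (e.orthonormal.2 haa'.symm)
  -- `m` is the distance of both eigenvalues from {0, 1}; the step `m / C` scales the form of `D`
  -- down to this margin.
  obtain ⟨m, hm, hma, hma', hma1, hma1'⟩ : ∃ m > 0, m ≤ μ a ∧ m ≤ μ a' ∧ m ≤ 1 - μ a ∧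
      m ≤ 1 - μ a' :=
    ⟨min (min (μ a) (μ a')) (min (1 - μ a) (1 - μ a')),
      lt_min (lt_min ha.1 ha'.1) (lt_min (sub_pos.2 ha.2) (sub_pos.2 ha'.2)),
      (min_le_left _ _).trans (min_le_left _ _), (min_le_left _ _).trans (min_le_right _ _),
      (min_le_right _ _).trans (min_le_left _ _), (min_le_right _ _).trans (min_le_right _ _)⟩
  have hXs := ((ContinuousLinearMap.nonneg_iff_isPositive _).1 hX.1.1).isSymmetric
  have he' : ∀ j, (1 - X) (e j) = ((1 - μ j : ℝ) : ℂ) • e j := fun j => by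
    rw [sub_apply, one_apply_eq_self, he, Complex.ofReal_sub, sub_smul, Complex.ofReal_one,
      one_smul]
  have hs : ∀ t : ℝ, ((((t : ℂ) • D : E →L[ℂ] E)) : E →ₗ[ℂ] E).IsSymmetric := fun t =>
    hDs.smul (Complex.conj_ofReal t)
  have hb : ∀ t : ℝ, |t| = m / C → ∀ x, |RCLike.re (inner ℂ (((t : ℂ) • D) x) x)| ≤
      m * (‖inner ℂ (e a) x‖ ^ 2 + ‖inner ℂ (e a') x‖ ^ 2) := fun t ht x => by
    rw [smul_apply, inner_smul_left, Complex.conj_ofReal, RCLike.re_eq_complex_re,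
      Complex.re_ofReal_mul, abs_mul, ht]
    have := mul_le_mul_of_nonneg_left (hDC x) (div_pos hm hC).le
    rw [← mul_assoc, div_mul_cancel₀ _ hC.ne'] at this
    exact this
  have key : ∀ t : ℝ, |t| = m / C → X + (t : ℂ) • D ∈ traceFiber T N c := by
    intro t ht
    refine ⟨⟨nonneg_add_of_diagonal hXs he hμ0 haa'.symm hma hma' (hs t) (hb t ht), ?_⟩, ?_, ?_⟩
    · have := nonneg_add_of_diagonal (X := 1 - X) (D := ((-t : ℝ) : ℂ) • D)
        (LinearMap.IsSymmetric.id.sub hXs) he' (fun j => sub_nonneg.2 (hμ1 j)) haa'.symm hma1 hma1'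
        (hs (-t)) (hb (-t) (by rwa [abs_neg]))
      rw [← sub_nonneg]
      convert this using 1
      rw [Complex.ofReal_neg, neg_smul]
      abel
    · rw [map_add, map_smul, hD1, hX.2.1, smul_zero, add_zero]
    · rw [map_add, map_smul, hDT, hX.2.2, smul_zero, add_zero]
  have hτ : 0 < m / C := div_pos hm hC
  have h1 := hmax (key (m / C) (abs_of_pos hτ))
  have h2 := hmax (key (-(m / C)) (by rw [abs_neg, abs_of_pos hτ]))
  obtain ⟨j₀, hj₀⟩ : ∃ j, D (b j) ≠ 0 := by
    by_contra! h
    exact hD0 (ContinuousLinearMap.coe_injective (b.toBasis.ext fun j => by simpa using h j))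
  have h3 : 0 < ∑ j, ‖((m / C : ℝ) : ℂ) • D (b j)‖ ^ 2 :=
    Finset.sum_pos' (fun _ _ => by positivity) ⟨j₀, Finset.mem_univ _, by
      have : ((m / C : ℝ) : ℂ) ≠ 0 := by exact_mod_cast hτ.ne'
      have := smul_ne_zero this hj₀
      positivity⟩
  have h4 : ∑ j, ‖(X + ((m / C : ℝ) : ℂ) • D) (b j)‖ ^ 2 +
      ∑ j, ‖(X + ((-(m / C) : ℝ) : ℂ) • D) (b j)‖ ^ 2 =
      2 * (∑ j, ‖X (b j)‖ ^ 2 + ∑ j, ‖((m / C : ℝ) : ℂ) • D (b j)‖ ^ 2) := by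
    rw [← Finset.sum_add_distrib, ← Finset.sum_add_distrib, Finset.mul_sum]
    refine Finset.sum_congr rfl fun j _ => ?_
    have := parallelogram_law_with_norm ℂ (X (b j)) (((m / C : ℝ) : ℂ) • D (b j))
    rw [add_apply, add_apply, smul_apply, smul_apply, Complex.ofReal_neg, neg_smul,
      ← sub_eq_add_neg]
    nlinarith
  simp only [Set.mem_ofPred_eq] at h1 h2
  linarith

/-- Every value of the fiber is attained by an orthonormal family. -/
theorem exists_orthonormal_of_traceFiber_nonempty {ι : Type*} [Fintype ι] {T : E →L[ℂ] E} {c : ℂ}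
    (h : (traceFiber T (Fintype.card ι) c).Nonempty) :
    ∃ w : ι → E, Orthonormal ℂ w ∧ ∑ i, inner ℂ (w i) (T (w i)) = c := by
  classical
  let b := stdOrthonormalBasis ℂ E
  obtain ⟨X, hX, hmax⟩ := (isCompact_traceFiber T _ c).exists_isMaxOn h
    (f := fun Y : E →L[ℂ] E => ∑ j, ‖Y (b j)‖ ^ 2) (by fun_prop)
  have hXp := (ContinuousLinearMap.nonneg_iff_isPositive _).1 hX.1.1
  have hXs := hXp.isSymmetric
  let e := hXs.eigenvectorBasis rfl
  let μ := hXs.eigenvalues rfl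
  have he : ∀ j, X (e j) = (μ j : ℂ) • e j := hXs.apply_eigenvectorBasis rfl
  have hμe : ∀ j, RCLike.re (inner ℂ (X (e j)) (e j)) = μ j := fun j => by
    rw [he, inner_smul_left, inner_self_eq_ofReal_norm_sq, e.orthonormal.1 j]
    simp
  have hμ0 : ∀ j, 0 ≤ μ j := fun j => by
    rw [← hμe]
    exact hXp.2 (e j)
  have hμ1 : ∀ j, μ j ≤ 1 := fun j => by
    have h1 := ((ContinuousLinearMap.le_def _ _).1 hX.1.2).2 (e j)
    rw [ContinuousLinearMap.reApplyInnerSelf_apply, sub_apply, inner_sub_left, map_sub, hμe,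
      one_apply_eq_self, inner_self_eq_ofReal_norm_sq, e.orthonormal.1 j] at h1
    simpa using h1
  have htr : ∀ S : E →L[ℂ] E, traceMul S X = ∑ j, (μ j : ℂ) * inner ℂ (e j) (S (e j)) := fun S => by
    rw [traceMul_eq_sum e]
    refine Finset.sum_congr rfl fun j _ => ?_
    rw [he, map_smul, inner_smul_right]
  have hμ : ∑ j, μ j = (Fintype.card ι : ℝ) := by
    have h1 := hX.2.1
    rw [htr] at h1
    simp only [ContinuousLinearMap.id_apply, inner_self_eq_ofReal_norm_sq, e.orthonormal.1] at h1
    have h2 : ((∑ j, μ j : ℝ) : ℂ) = ((Fintype.card ι : ℝ) : ℂ) := by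
      rw [Complex.ofReal_sum, Complex.ofReal_natCast, ← h1]
      simp
    exact_mod_cast h2
  have h01 := eq_zero_or_one_of_maximal hX hmax he hμ0 hμ1 hμ
  have hμ' : ∀ j, μ j = if μ j = 1 then 1 else 0 := fun j => by
    rcases h01 j with h | h <;> simp [h]
  have hcard : Fintype.card ι = Fintype.card {j // μ j = 1} := by
    rw [Finset.sum_congr rfl fun j _ => hμ' j, Finset.sum_boole] at hμ
    rw [Fintype.card_subtype]
    exact_mod_cast hμ.symm
  -- All eigenvalues are 0 or 1, so the trace counts the eigenvectors for 1, and these form the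
  -- required family.
  let φ : ι ≃ {j // μ j = 1} := Fintype.equivOfCardEq hcard
  refine ⟨fun i => e (φ i), e.orthonormal.comp _ (Subtype.val_injective.comp φ.injective), ?_⟩
  rw [← hX.2.2, htr, φ.sum_comp (fun j => inner ℂ (e j) (T (e j))),
    ← Finset.sum_subtype (Finset.univ.filter fun j => μ j = 1) (by simp)
      (fun j => inner ℂ (e j) (T (e j))), Finset.sum_filter]
  refine Finset.sum_congr rfl fun j _ => ?_
  rcases h01 j with h | h <;> simp [h]

/-- Convexity of the higher numerical range. -/
theorem convex_setOf_sum_inner_orthonormal (ι : Type*) [Fintype ι] (T : E →L[ℂ] E) :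
    Convex ℝ {c : ℂ | ∃ w : ι → E, Orthonormal ℂ w ∧ ∑ i, inner ℂ (w i) (T (w i)) = c} := by
  rintro _ ⟨v, hv, rfl⟩ _ ⟨w, hw, rfl⟩ s t hs ht hst
  have h1 := traceFiber_sum_rankOne T hv
  have h2 := traceFiber_sum_rankOne T hw
  refine exists_orthonormal_of_traceFiber_nonempty
    ⟨s • (∑ i, rankOne ℂ (v i) (v i)) + t • ∑ i, rankOne ℂ (w i) (w i),
      convex_Icc _ _ h1.1 h2.1 hs ht hst, ?_, ?_⟩
  · rw [map_add, LinearMap.map_smul_of_tower, LinearMap.map_smul_of_tower, h1.2.1, h2.2.1,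
      ← add_smul, hst, one_smul]
  · rw [map_add, LinearMap.map_smul_of_tower, LinearMap.map_smul_of_tower, h1.2.2, h2.2.2]

end NumericalRangeConvexity

/-! ### Convexity of the values over top frames -/

section TopFrameValues

open Module InnerProductSpace

variable {E F : Type*} [NormedAddCommGroup E] [InnerProductSpace ℂ E] [FiniteDimensional ℂ E]
  [NormedAddCommGroup F] [InnerProductSpace ℂ F] [FiniteDimensional ℂ F]

theorem inner_eq_zero_of_adjoint_apply_eq_smul {T : E →ₗ[ℂ] F} {x y : E} {a b : ℝ}
    (hx : LinearMap.adjoint T (T x) = (a : ℂ) • x) (hy : LinearMap.adjoint T (T y) = (b : ℂ) • y)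
    (hab : a ≠ b) : inner ℂ x y = 0 := by
  have h : inner ℂ (LinearMap.adjoint T (T x)) y = inner ℂ x (LinearMap.adjoint T (T y)) := by
    rw [LinearMap.adjoint_inner_left, LinearMap.adjoint_inner_right]
  rw [hx, hy, inner_smul_left, inner_smul_right, Complex.conj_ofReal, ← sub_eq_zero, ← sub_mul,
    mul_eq_zero, sub_eq_zero] at h
  exact h.resolve_left fun h => hab (by exact_mod_cast h)

/-- Both sums are the trace of `M` composed with the orthogonal projection onto the common span. -/
theorem sum_inner_eq_of_span_eq {ι : Type*} [Fintype ι] (M : E →L[ℂ] E) {v w : ι → E}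
    (hv : Orthonormal ℂ v) (hw : Orthonormal ℂ w)
    (h : Submodule.span ℂ (Set.range v) = Submodule.span ℂ (Set.range w)) :
    ∑ i, inner ℂ (v i) (M (v i)) = ∑ i, inner ℂ (w i) (M (w i)) := by
  have key : ∀ {S : Submodule ℂ E} {x : ι → E}, Orthonormal ℂ x →
      Submodule.span ℂ (Set.range x) = S →
      S.starProjection = ∑ i, rankOne ℂ (x i) (x i) := by
    rintro S x hx rfl
    let y : ι → Submodule.span ℂ (Set.range x) := fun i => ⟨x i, Submodule.subset_span ⟨i, rfl⟩⟩
    have hy : Orthonormal ℂ y := ⟨fun i => hx.1 i, fun i j hij => hx.2 hij⟩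
    have hs : ⊤ ≤ Submodule.span ℂ (Set.range y) :=
      (hy.linearIndependent.span_eq_top_of_card_eq_finrank'
        (finrank_span_eq_card hx.linearIndependent).symm).ge
    rw [(OrthonormalBasis.mk hy hs).starProjection_eq_sum_rankOne]
    simp [y]
  have h1 := congrArg (traceMul M) ((key hv h).symm.trans (key hw rfl))
  simpa only [map_sum, traceMul_rankOne] using h1

/-- Eigenspaces for singular values above the k-th one are exhausted by any top frame, so only the
eigenspace of the last value leaves a choice. The index `k - 1` is the k-th singular value, counted
from 0. -/
theorem IsTopFrame.span_eq {T : E →ₗ[ℂ] F} {k : ℕ} (hk : 1 ≤ k) {v w : Fin k → E}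
    (hv : IsTopFrame T v) (hw : IsTopFrame T w) :
    Submodule.span ℂ (Set.range fun i : {i : Fin k // ¬ T.singularValues i =
      T.singularValues (k - 1)} => v i) =
    Submodule.span ℂ (Set.range fun i : {i : Fin k // ¬ T.singularValues i =
      T.singularValues (k - 1)} => w i) := by
  obtain ⟨u, hu⟩ := exists_rightSingularBasis T
  have hkn : k ≤ finrank ℂ E := by
    simpa using hv.1.linearIndependent.fintype_card_le_finrank
  have hinj : ∀ {a b : ℕ}, T.singularValues a ^ 2 = T.singularValues b ^ 2 →
      T.singularValues a = T.singularValues b := fun {a b} h =>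
    (sq_eq_sq₀ (T.singularValues_nonneg a) (T.singularValues_nonneg b)).1 h
  have key : ∀ {x : Fin k → E}, IsTopFrame T x →
      Submodule.span ℂ (Set.range fun i : {i : Fin k // ¬ T.singularValues i =
        T.singularValues (k - 1)} => x i) =
      Submodule.span ℂ (Set.range fun i : {i : Fin k // ¬ T.singularValues i =
        T.singularValues (k - 1)} => u (Fin.castLE hkn i)) := by
    intro x hx
    refine Submodule.eq_of_le_of_finrank_eq (Submodule.span_le.2 ?_) ?_
    · rintro _ ⟨⟨i, hi⟩, rfl⟩
      dsimp only
      rw [← u.sum_repr' (x i)]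
      refine Submodule.sum_mem _ fun j _ => ?_
      by_cases hj : T.singularValues j = T.singularValues i
      · refine Submodule.smul_mem _ _ (Submodule.subset_span ?_)
        have hlt : (j : ℕ) < k := by
          by_contra! hjk
          refine hi (le_antisymm ?_ (T.singularValues_antitone (by have := i.2; omega)))
          rw [← hj]
          exact T.singularValues_antitone (by omega)
        exact ⟨⟨⟨j, hlt⟩, fun h => hi (hj.symm.trans h)⟩, rfl⟩
      · rw [inner_eq_zero_of_adjoint_apply_eq_smul (hu j) (hx.2 i) fun h => hj (hinj h),
          zero_smul]
        exact Submodule.zero_mem _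
    · exact (finrank_span_eq_card (hx.1.comp _ Subtype.val_injective).linearIndependent).trans
        (finrank_span_eq_card (u.orthonormal.comp _
          ((Fin.castLE_injective hkn).comp Subtype.val_injective)).linearIndependent).symm
  exact (key hv).trans (key hw).symm

/-- Replacing the vectors of a top frame for the smallest of its singular values. -/
theorem IsTopFrame.replace {T : E →ₗ[ℂ] F} {k : ℕ} {v : Fin k → E} (hv : IsTopFrame T v) {l : ℝ}
    (hl : 0 ≤ l) [DecidablePred fun i : Fin k => T.singularValues i = l]
    {w : {i : Fin k // T.singularValues i = l} → E} (hw : Orthonormal ℂ w)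
    (hwl : ∀ i, LinearMap.adjoint T (T (w i)) = ((l ^ 2 : ℝ) : ℂ) • w i) :
    IsTopFrame T fun i => if h : T.singularValues i = l then w ⟨i, h⟩ else v i := by
  have hne : ∀ {i : Fin k}, ¬ T.singularValues i = l → l ^ 2 ≠ T.singularValues i ^ 2 :=
    fun {i} h he => h ((sq_eq_sq₀ hl (T.singularValues_nonneg i)).1 he).symm
  refine ⟨⟨fun i => ?_, fun i j hij => ?_⟩, fun i => ?_⟩
  · dsimp only
    split_ifs
    exacts [hw.1 _, hv.1.1 _]
  · dsimp only
    split_ifs with h1 h2 h2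
    · exact hw.2 fun h => hij (congrArg Subtype.val h)
    · exact inner_eq_zero_of_adjoint_apply_eq_smul (hwl _) (hv.2 j) (hne h2)
    · exact inner_eq_zero_of_adjoint_apply_eq_smul (hv.2 i) (hwl _) (hne h1).symm
    · exact hv.1.2 hij
  · dsimp only
    split_ifs with h
    · rw [hwl, h]
    · exact hv.2 i

/-- The values `∑ ⟨v i, M (v i)⟩` over all top frames `v` of `T` form a convex set. -/
theorem convex_setOf_sum_inner_isTopFrame (T : E →ₗ[ℂ] F) (M : E →L[ℂ] E) {k : ℕ} (hk : 1 ≤ k) :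
    Convex ℝ {c : ℂ | ∃ v : Fin k → E, IsTopFrame T v ∧ ∑ i, inner ℂ (v i) (M (v i)) = c} := by
  classical
  rintro _ ⟨v, hv, rfl⟩ _ ⟨w, hw, rfl⟩ s t hs ht hst
  set l := T.singularValues (k - 1) with hl
  -- Compressing `M` to this eigenspace preserves its quadratic form there, so the higher numerical
  -- range theorem applies to the varying part; the remaining part is the same for `v` and `w`.
  let G : Submodule ℂ E := Module.End.eigenspace (LinearMap.adjoint T ∘ₗ T) ((l ^ 2 : ℝ) : ℂ)
  let MG : G →L[ℂ] G := G.orthogonalProjectionOnto ∘L M ∘L G.subtypeL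
  have hMG : ∀ x : G, inner ℂ x (MG x) = inner ℂ (x : E) (M x) := fun x =>
    Submodule.inner_orthogonalProjectionOnto_eq_of_mem_left x (M x)
  have hG : ∀ {x : Fin k → E}, IsTopFrame T x →
      ∃ y : {i : Fin k // T.singularValues i = l} → G, Orthonormal ℂ y ∧
        ∑ i, inner ℂ (y i) (MG (y i)) =
          ∑ i : {i : Fin k // T.singularValues i = l}, inner ℂ (x i) (M (x i)) := by
    intro x hx
    refine ⟨fun i => ⟨x i, Module.End.mem_eigenspace_iff.2 ?_⟩, ⟨fun i => hx.1.1 i,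
      fun i j hij => hx.1.2 fun h => hij (Subtype.ext h)⟩,
      Finset.sum_congr rfl fun i _ => hMG _⟩
    have := hx.2 i
    rwa [i.2] at this
  obtain ⟨y, hy, hye⟩ := convex_setOf_sum_inner_orthonormal _ MG (hG hv) (hG hw) hs ht hst
  have hsplit := fun f : Fin k → ℂ =>
    (Fintype.sum_subtype_add_sum_subtype (fun i : Fin k => T.singularValues i = l) f).symm
  have hvw : ∑ i : {i : Fin k // ¬ T.singularValues i = l}, inner ℂ (v i) (M (v i)) =
      ∑ i : {i : Fin k // ¬ T.singularValues i = l}, inner ℂ (w i) (M (w i)) :=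
    sum_inner_eq_of_span_eq M (hv.1.comp _ Subtype.val_injective)
      (hw.1.comp _ Subtype.val_injective) (hv.span_eq hk hw)
  refine ⟨_, hv.replace (T.singularValues_nonneg _) (w := fun i => (y i : E))
    ⟨fun i => hy.1 i, fun i j hij => hy.2 hij⟩
    fun i => Module.End.mem_eigenspace_iff.1 (y i).2, ?_⟩
  rw [hsplit, hsplit, hsplit, ← hvw, smul_add, smul_add, add_add_add_comm, ← hye, ← add_smul,
    hst, one_smul]
  congr 1
  · refine Finset.sum_congr rfl fun i _ => ?_
    rw [dif_pos i.2, hMG]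
  · refine Finset.sum_congr rfl fun i _ => ?_
    rw [dif_neg i.2]

end TopFrameValues

/-! ### Ky Fan norms, support functionals and directional derivatives -/

section KyFan

open Module Filter Topology

variable {E F : Type*} [NormedAddCommGroup E] [InnerProductSpace ℂ E] [FiniteDimensional ℂ E]
  [NormedAddCommGroup F] [InnerProductSpace ℂ F] [FiniteDimensional ℂ F]

/-- The Ky Fan `p`-`k` norm of a linear map. -/
noncomputable def LinearMap.kyFanNorm (p : ℝ) (k : ℕ) (T : E →ₗ[ℂ] F) : ℝ :=
  (∑ i ∈ Finset.range k, T.singularValues i ^ p) ^ (1 / p)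

theorem LinearMap.sum_singularValues_rpow_nonneg (p : ℝ) (k : ℕ) (T : E →ₗ[ℂ] F) :
    0 ≤ ∑ i ∈ Finset.range k, T.singularValues i ^ p :=
  Finset.sum_nonneg fun i _ => Real.rpow_nonneg (T.singularValues_nonneg i) p

theorem LinearMap.kyFanNorm_nonneg (p : ℝ) (k : ℕ) (T : E →ₗ[ℂ] F) : 0 ≤ T.kyFanNorm p k :=
  Real.rpow_nonneg (T.sum_singularValues_rpow_nonneg p k) _

theorem LinearMap.kyFanNorm_rpow {p : ℝ} (hp : 0 < p) (k : ℕ) (T : E →ₗ[ℂ] F) :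
    T.kyFanNorm p k ^ p = ∑ i ∈ Finset.range k, T.singularValues i ^ p := by
  rw [kyFanNorm, ← Real.rpow_mul (T.sum_singularValues_rpow_nonneg p k), one_div,
    inv_mul_cancel₀ hp.ne', Real.rpow_one]

theorem sq_rpow_eq {x : ℝ} (hx : 0 ≤ x) (s : ℝ) : (x ^ 2) ^ s = x ^ (2 * s) := by
  rw [← Real.rpow_natCast, ← Real.rpow_mul hx]
  norm_num

/-- Here `2 ≤ p` matters: it makes the power `p / 2` of the squared norms convex. -/
theorem Orthonormal.sum_norm_rpow_le_kyFanNorm {p : ℝ} (hp : 2 ≤ p) {k : ℕ} (T : E →ₗ[ℂ] F)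
    {v : Fin k → E} (hv : Orthonormal ℂ v) : ∑ i, ‖T (v i)‖ ^ p ≤ T.kyFanNorm p k ^ p := by
  have h := sum_norm_sq_rpow_le_sum_singularValues T (q := p / 2) (by linarith) hv
  simp_rw [sq_rpow_eq (norm_nonneg _), sq_rpow_eq (T.singularValues_nonneg _),
    mul_div_cancel₀ p (two_ne_zero' ℝ)] at h
  rwa [T.kyFanNorm_rpow (by linarith)]

theorem IsTopFrame.sum_norm_rpow_eq {p : ℝ} (hp : 0 < p) {k : ℕ} {T : E →ₗ[ℂ] F}
    {v : Fin k → E} (hv : IsTopFrame T v) : ∑ i, ‖T (v i)‖ ^ p = T.kyFanNorm p k ^ p := by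
  rw [T.kyFanNorm_rpow hp, ← Fin.sum_univ_eq_sum_range (fun i => T.singularValues i ^ p)]
  simp_rw [hv.norm_apply]

theorem LinearMap.kyFanNorm_smul {p : ℝ} (hp : 2 ≤ p) {k : ℕ} (hk : k ≤ finrank ℂ E) (z : ℂ)
    (T : E →ₗ[ℂ] F) : (z • T).kyFanNorm p k = ‖z‖ * T.kyFanNorm p k := by
  have hp0 : 0 < p := by linarith
  obtain ⟨v, hv⟩ := exists_isTopFrame T hk
  obtain ⟨w, hw⟩ := exists_isTopFrame (z • T) hk
  have hz : ∀ x : Fin k → E,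
      ∑ i, ‖(z • T) (x i)‖ ^ p = ‖z‖ ^ p * ∑ i, ‖T (x i)‖ ^ p := fun x => by
    rw [Finset.mul_sum]
    refine Finset.sum_congr rfl fun i _ => ?_
    rw [LinearMap.smul_apply, norm_smul, Real.mul_rpow (norm_nonneg _) (norm_nonneg _)]
  have h : (z • T).kyFanNorm p k ^ p = (‖z‖ * T.kyFanNorm p k) ^ p := by
    rw [Real.mul_rpow (norm_nonneg _) (T.kyFanNorm_nonneg p k)]
    refine le_antisymm ?_ ?_
    · rw [← hw.sum_norm_rpow_eq hp0, hz]
      exact mul_le_mul_of_nonneg_left (hw.1.sum_norm_rpow_le_kyFanNorm hp T)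
        (Real.rpow_nonneg (norm_nonneg _) _)
    · rw [← hv.sum_norm_rpow_eq hp0, ← hz]
      exact hv.1.sum_norm_rpow_le_kyFanNorm hp _
  exact (Real.rpow_left_inj ((z • T).kyFanNorm_nonneg p k)
    (mul_nonneg (norm_nonneg _) (T.kyFanNorm_nonneg p k)) hp0.ne').1 h

/-- The support functional at `T` attached to a top frame is bounded by the Ky Fan norm. -/
theorem IsTopFrame.norm_sum_le {p : ℝ} (hp : 2 ≤ p) {k : ℕ} {T : E →ₗ[ℂ] F} {v : Fin k → E}
    (hv : IsTopFrame T v) (S : E →ₗ[ℂ] F) :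
    ‖∑ i : Fin k, ((T.singularValues i ^ (p - 2) : ℝ) : ℂ) * inner ℂ (T (v i)) (S (v i))‖ ≤
      T.kyFanNorm p k ^ (p - 1) * S.kyFanNorm p k := by
  have hp0 : 0 < p := by linarith
  have hpq : p.HolderConjugate p.conjExponent := Real.HolderConjugate.conjExponent (by linarith)
  have hσ := T.singularValues_nonneg
  -- Cauchy–Schwarz in each term, then Hölder; the conjugate exponent turns `σ ^ (p - 1)` back into
  -- `σ ^ p`.
  calc _ ≤ ∑ i : Fin k, ‖S (v i)‖ * T.singularValues i ^ (p - 1) := by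
        refine norm_sum_le_of_le _ fun i _ => ?_
        have h1 : T.singularValues i ^ (p - 1) =
            T.singularValues i ^ (p - 2) * T.singularValues i := by
          rw [← Real.rpow_add_one' (hσ i) (by linarith)]
          congr 1
          ring
        rw [norm_mul, Complex.norm_real, Real.norm_of_nonneg (Real.rpow_nonneg (hσ i) _), h1,
          mul_comm ‖S (v i)‖, mul_assoc]
        refine mul_le_mul_of_nonneg_left ?_ (Real.rpow_nonneg (hσ i) _)
        have := norm_inner_le_norm (𝕜 := ℂ) (T (v i)) (S (v i))
        rwa [hv.norm_apply] at this
    _ ≤ (∑ i, ‖S (v i)‖ ^ p) ^ (1 / p) *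
          (∑ i : Fin k, (T.singularValues i ^ (p - 1)) ^ p.conjExponent) ^ (1 / p.conjExponent) :=
        Real.inner_le_Lp_mul_Lq_of_nonneg _ hpq (fun _ _ => norm_nonneg _)
          fun i _ => Real.rpow_nonneg (hσ i) _
    _ ≤ S.kyFanNorm p k * T.kyFanNorm p k ^ (p - 1) := by
        have h2 : ∀ i : Fin k, (T.singularValues i ^ (p - 1)) ^ p.conjExponent =
            T.singularValues i ^ p := fun i => by
          rw [← Real.rpow_mul (hσ i), hpq.sub_one_mul_conj]
        have h3 : (p - 1) = p * (1 / p.conjExponent) := by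
          rw [Real.conjExponent]
          field_simp
        simp_rw [h2]
        rw [Fin.sum_univ_eq_sum_range (fun i => T.singularValues i ^ p), h3,
          Real.rpow_mul (T.kyFanNorm_nonneg p k), T.kyFanNorm_rpow hp0]
        refine mul_le_mul_of_nonneg_right ?_
          (Real.rpow_nonneg (T.sum_singularValues_rpow_nonneg p k) _)
        rw [LinearMap.kyFanNorm, ← S.kyFanNorm_rpow hp0]
        exact Real.rpow_le_rpow (Finset.sum_nonneg fun _ _ => by positivity)
          (hv.1.sum_norm_rpow_le_kyFanNorm hp S) (by positivity)
    _ = _ := mul_comm _ _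

/-- Shows that the bound of `IsTopFrame.norm_sum_le` is attained at `T` itself. -/
theorem IsTopFrame.sum_self_eq {p : ℝ} (hp : 2 ≤ p) {k : ℕ} {T : E →ₗ[ℂ] F} {v : Fin k → E}
    (hv : IsTopFrame T v) :
    ∑ i : Fin k, ((T.singularValues i ^ (p - 2) : ℝ) : ℂ) * inner ℂ (T (v i)) (T (v i)) =
      ((T.kyFanNorm p k ^ p : ℝ) : ℂ) := by
  rw [T.kyFanNorm_rpow (by linarith),
    ← Fin.sum_univ_eq_sum_range (fun i => T.singularValues i ^ p), Complex.ofReal_sum]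
  refine Finset.sum_congr rfl fun i _ => ?_
  rw [inner_self_eq_ofReal_norm_sq, hv.norm_apply, ← Complex.ofReal_mul, ← Real.rpow_natCast,
    ← Real.rpow_add' (T.singularValues_nonneg i) (by push_cast; linarith)]
  congr 2
  push_cast
  ring

theorem isCompact_setOf_isTopFrame (T : E →ₗ[ℂ] F) (k : ℕ) :
    IsCompact {v : Fin k → E | IsTopFrame T v} := by
  have : ProperSpace E := FiniteDimensional.proper ℂ E
  have hTc : Continuous T := T.continuous_of_finiteDimensional
  have hTa : Continuous (LinearMap.adjoint T) := LinearMap.continuous_of_finiteDimensional _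
  refine Metric.isCompact_of_isClosed_isBounded ?_ ?_
  · simp only [IsTopFrame, orthonormal_iff_ite, Set.ofPred_and, Set.ofPred_forall]
    exact (isClosed_iInter fun i => isClosed_iInter fun j =>
      isClosed_eq (by fun_prop) continuous_const).inter
      (isClosed_iInter fun i => isClosed_eq (by fun_prop) (by fun_prop))
  · refine (Metric.isBounded_closedBall (x := 0) (r := 1)).subset fun v hv => ?_
    rw [mem_closedBall_zero_iff, pi_norm_le_iff_of_nonneg zero_le_one]
    exact fun i => (hv.1.1 i).le

/-- A limit of top frames of operators `T + τ S`, as `τ → 0`, is a top frame of `T`. -/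
theorem isTopFrame_of_tendsto {T S : E →ₗ[ℂ] F} {k : ℕ} {τ : ℕ → ℝ} (hτ : Tendsto τ atTop (𝓝 0))
    {x : ℕ → Fin k → E} (hx : ∀ n, IsTopFrame (T + (τ n : ℂ) • S) (x n)) {v : Fin k → E}
    (hxv : Tendsto x atTop (𝓝 v)) : IsTopFrame T v := by
  have hTc : Continuous T := T.continuous_of_finiteDimensional
  have hSc : Continuous S := S.continuous_of_finiteDimensional
  have hxi : ∀ i, Tendsto (fun n => x n i) atTop (𝓝 (v i)) := tendsto_pi_nhds.1 hxv
  have hτc : Tendsto (fun n => (τ n : ℂ)) atTop (𝓝 0) := by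
    have := (Complex.continuous_ofReal.tendsto 0).comp hτ
    rwa [Complex.ofReal_zero] at this
  have hlim : ∀ {y : ℕ → E} {a : E}, Tendsto y atTop (𝓝 a) →
      Tendsto (fun n => (T + (τ n : ℂ) • S) (y n)) atTop (𝓝 (T a)) := fun {y a} hy => by
    simpa using ((hTc.tendsto a).comp hy).add (hτc.smul ((hSc.tendsto a).comp hy))
  have hv : Orthonormal ℂ v := by
    rw [orthonormal_iff_ite]
    intro i j
    refine tendsto_nhds_unique ((hxi i).inner (hxi j)) ?_
    simp_rw [orthonormal_iff_ite.1 (hx _).1 i j]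
    exact tendsto_const_nhds
  have hkn : k ≤ finrank ℂ E := by
    simpa using hv.linearIndependent.fintype_card_le_finrank
  have hKF : ∀ (R : E →ₗ[ℂ] F) {j : ℕ} {y : Fin j → E}, Orthonormal ℂ y →
      ∑ i, ‖R (y i)‖ ^ 2 ≤ ∑ i ∈ Finset.range j, R.singularValues i ^ 2 := fun R j y hy => by
    simpa using sum_norm_sq_rpow_le_sum_singularValues R le_rfl hy
  -- Ky Fan for `T` gives one inequality; the other is the limit of Ky Fan for the perturbed
  -- operators, tested on a top frame of `T`. Consecutive `j` then isolate each singular value.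
  have hsum : ∀ (j : ℕ) (hj : j ≤ k), ∑ i : Fin j, ‖T (v (Fin.castLE hj i))‖ ^ 2 =
      ∑ i ∈ Finset.range j, T.singularValues i ^ 2 := by
    intro j hj
    refine le_antisymm (hKF T (hv.comp _ (Fin.castLE_injective hj))) ?_
    obtain ⟨u, hu⟩ := exists_isTopFrame T (hj.trans hkn)
    rw [← Fin.sum_univ_eq_sum_range (fun i => T.singularValues i ^ 2)]
    simp_rw [← hu.norm_apply]
    refine le_of_tendsto_of_tendsto'
      (tendsto_finsetSum _ fun i _ => (hlim (tendsto_const_nhds (x := u i))).norm.pow 2)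
      (tendsto_finsetSum _ fun i _ => (hlim (hxi (Fin.castLE hj i))).norm.pow 2) fun n => ?_
    refine (hKF _ hu.1).trans (le_of_eq ?_)
    rw [← Fin.sum_univ_eq_sum_range (fun i => (T + (τ n : ℂ) • S).singularValues i ^ 2)]
    simp_rw [(hx n).norm_apply]
    rfl
  have hnorm : ∀ i : Fin k, ‖T (v i)‖ ^ 2 = T.singularValues i ^ 2 := fun i => by
    have h1 := hsum (i + 1) i.2
    have h2 := hsum i i.2.le
    rw [Fin.sum_univ_castSucc, Finset.sum_range_succ, ← h2] at h1
    exact add_left_cancel h1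
  refine ⟨hv, fun i => ext_inner_left ℂ fun y => ?_⟩
  rw [LinearMap.adjoint_inner_right, inner_smul_right, ← hnorm]
  have h1 := (hlim (tendsto_const_nhds (x := y))).inner (𝕜 := ℂ) (hlim (hxi i))
  have h2 := ((Complex.continuous_ofReal.tendsto _).comp ((hlim (hxi i)).norm.pow 2)).mul
    ((tendsto_const_nhds (x := y)).inner (𝕜 := ℂ) (hxi i))
  refine tendsto_nhds_unique h1 (h2.congr fun n => ?_)
  rw [← LinearMap.adjoint_inner_right, (hx n).2 i, inner_smul_right, Function.comp_apply,
    (hx n).norm_sq_apply]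

/-- A bound on the one-sided directional derivative of the `p`-th power of the Ky Fan norm is
realised by a top frame. -/
theorem exists_isTopFrame_of_kyFanNorm_rpow_ge {T S : E →ₗ[ℂ] F} {k : ℕ} (hk : k ≤ finrank ℂ E)
    {p : ℝ} (hp : 2 ≤ p) {c : ℝ}
    (h : ∀ t : ℝ, 0 < t →
      T.kyFanNorm p k ^ p - t * (p * c) ≤ (T + (t : ℂ) • S).kyFanNorm p k ^ p) :
    ∃ v : Fin k → E, IsTopFrame T v ∧
      -c ≤ (∑ i : Fin k, ((T.singularValues i ^ (p - 2) : ℝ) : ℂ) *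
        inner ℂ (T (v i)) (S (v i))).re := by
  have hp0 : 0 < p := by linarith
  have : ProperSpace E := FiniteDimensional.proper ℂ E
  have hTc : Continuous T := T.continuous_of_finiteDimensional
  have hSc : Continuous S := S.continuous_of_finiteDimensional
  choose y hy using fun n : ℕ => exists_isTopFrame (T + ((1 / ((n : ℝ) + 1) : ℝ) : ℂ) • S) hk
  obtain ⟨v, -, φ, hφ, hv⟩ := (isCompact_closedBall (0 : Fin k → E) 1).tendsto_subseq
    (x := y) fun n => by
      rw [mem_closedBall_zero_iff, pi_norm_le_iff_of_nonneg zero_le_one]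
      exact fun i => ((hy n).1.1 i).le
  obtain ⟨τ, hτe⟩ : ∃ τ : ℕ → ℝ, τ = fun n => 1 / ((φ n : ℝ) + 1) := ⟨_, rfl⟩
  have hτ : Tendsto τ atTop (𝓝 0) := by
    rw [hτe]
    exact tendsto_one_div_add_atTop_nhds_zero_nat.comp hφ.tendsto_atTop
  have hτ0 : ∀ n, 0 < τ n := fun n => by
    rw [hτe]
    positivity
  have hx : ∀ n, IsTopFrame (T + (τ n : ℂ) • S) (y (φ n)) := fun n => by
    rw [hτe]
    exact hy (φ n)
  have hvT := isTopFrame_of_tendsto hτ hx hv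
  refine ⟨v, hvT, ?_⟩
  have hxi : ∀ i, Tendsto (fun n => y (φ n) i) atTop (𝓝 (v i)) := tendsto_pi_nhds.1 hv
  have hτc : Tendsto (fun n => (τ n : ℂ)) atTop (𝓝 0) := by
    have := (Complex.continuous_ofReal.tendsto 0).comp hτ
    rwa [Complex.ofReal_zero] at this
  have hTx : ∀ i, Tendsto (fun n => T (y (φ n) i)) atTop (𝓝 (T (v i))) := fun i =>
    (hTc.tendsto _).comp (hxi i)
  have hSx : ∀ i, Tendsto (fun n => S (y (φ n) i)) atTop (𝓝 (S (v i))) := fun i =>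
    (hSc.tendsto _).comp (hxi i)
  have hRx : ∀ i, Tendsto (fun n => (T + (τ n : ℂ) • S) (y (φ n) i)) atTop (𝓝 (T (v i))) :=
    fun i => by simpa using (hTx i).add (hτc.smul (hSx i))
  -- On a top frame of the perturbed operator its norm is attained, while that of `T` is only
  -- bounded below. The tangent inequality at the perturbed point, divided by `τ n`, gives the
  -- bound.
  have hbound : ∀ n, -(p * c) ≤ ∑ i,
      p / 2 * (‖(T + (τ n : ℂ) • S) (y (φ n) i)‖ ^ 2) ^ (p / 2 - 1) *
        (2 * (inner ℂ (T (y (φ n) i)) (S (y (φ n) i))).re + τ n * ‖S (y (φ n) i)‖ ^ 2) := by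
    intro n
    have h1 := h (τ n) (hτ0 n)
    rw [← (hx n).sum_norm_rpow_eq hp0] at h1
    have h2 := (hx n).1.sum_norm_rpow_le_kyFanNorm hp T
    refine le_of_mul_le_mul_left ?_ (hτ0 n)
    calc τ n * -(p * c) ≤ ∑ i, ‖(T + (τ n : ℂ) • S) (y (φ n) i)‖ ^ p -
          ∑ i, ‖T (y (φ n) i)‖ ^ p := by linarith
      _ ≤ _ := by
        rw [← Finset.sum_sub_distrib, Finset.mul_sum]
        refine Finset.sum_le_sum fun i _ => ?_
        have h3 := rpow_sub_rpow_le (q := p / 2) (by linarith)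
          (sq_nonneg ‖T (y (φ n) i)‖) (sq_nonneg ‖(T + (τ n : ℂ) • S) (y (φ n) i)‖)
        have h4 : ‖(T + (τ n : ℂ) • S) (y (φ n) i)‖ ^ 2 - ‖T (y (φ n) i)‖ ^ 2 =
            τ n * (2 * (inner ℂ (T (y (φ n) i)) (S (y (φ n) i))).re +
              τ n * ‖S (y (φ n) i)‖ ^ 2) := by
          rw [LinearMap.add_apply, LinearMap.smul_apply, @norm_add_sq ℂ, inner_smul_right,
            norm_smul, Complex.norm_real, Real.norm_of_nonneg (hτ0 n).le,
            RCLike.re_eq_complex_re, Complex.re_ofReal_mul]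
          ring
        rw [h4, sq_rpow_eq (norm_nonneg _), sq_rpow_eq (norm_nonneg _),
          mul_div_cancel₀ p (two_ne_zero' ℝ)] at h3
        refine h3.trans (le_of_eq ?_)
        ring
  have hlim : Tendsto (fun n => ∑ i,
      p / 2 * (‖(T + (τ n : ℂ) • S) (y (φ n) i)‖ ^ 2) ^ (p / 2 - 1) *
        (2 * (inner ℂ (T (y (φ n) i)) (S (y (φ n) i))).re + τ n * ‖S (y (φ n) i)‖ ^ 2)) atTop
      (𝓝 (∑ i, p / 2 * (‖T (v i)‖ ^ 2) ^ (p / 2 - 1) *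
        (2 * (inner ℂ (T (v i)) (S (v i))).re + 0 * ‖S (v i)‖ ^ 2))) := by
    refine tendsto_finsetSum _ fun i _ => ?_
    -- The exponent `p / 2 - 1` is nonnegative, so the power stays continuous where `T (v i)`
    -- vanishes.
    refine ((((hRx i).norm.pow 2).rpow_const (Or.inr (by linarith))).const_mul _).mul ?_
    exact (((Complex.continuous_re.tendsto _).comp ((hTx i).inner (hSx i))).const_mul 2).add
      (hτ.mul ((hSx i).norm.pow 2))
  have hfin := ge_of_tendsto' hlim hbound
  have he : ∑ i, p / 2 * (‖T (v i)‖ ^ 2) ^ (p / 2 - 1) *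
        (2 * (inner ℂ (T (v i)) (S (v i))).re + 0 * ‖S (v i)‖ ^ 2) =
      p * (∑ i : Fin k, ((T.singularValues i ^ (p - 2) : ℝ) : ℂ) *
        inner ℂ (T (v i)) (S (v i))).re := by
    rw [Complex.re_sum, Finset.mul_sum]
    refine Finset.sum_congr rfl fun i _ => ?_
    rw [Complex.re_ofReal_mul, sq_rpow_eq (norm_nonneg _), hvT.norm_apply,
      show 2 * (p / 2 - 1) = p - 2 by ring]
    ring
  rw [he] at hfin
  nlinarith

end KyFan

/-! ### Orthogonality versus support functionals -/

section Duality

open Module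

variable {E F : Type*} [NormedAddCommGroup E] [InnerProductSpace ℂ E] [FiniteDimensional ℂ E]
  [NormedAddCommGroup F] [InnerProductSpace ℂ F] [FiniteDimensional ℂ F]

/-- A compact convex set that meets every half plane containing a disc centred at `0` meets the
disc. -/
theorem exists_norm_le_of_convex {W : Set ℂ} (hne : W.Nonempty) (hcpt : IsCompact W)
    (hconv : Convex ℝ W) {r : ℝ} (hr0 : 0 ≤ r)
    (h : ∀ w : ℂ, ‖w‖ = 1 → ∃ c ∈ W, -r ≤ (w * c).re) :
    ∃ c ∈ W, ‖c‖ ≤ r := by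
  obtain ⟨c₀, hc₀, hmin⟩ := exists_norm_eq_iInf_of_complete_convex hne hcpt.isComplete hconv 0
  have hin := (norm_eq_iInf_iff_real_inner_le_zero hconv hc₀).1 hmin
  refine ⟨c₀, hc₀, ?_⟩
  rcases eq_or_ne c₀ 0 with rfl | h0
  · rwa [norm_zero]
  · have hn : 0 < ‖c₀‖ := norm_pos_iff.2 h0
    -- Test the direction that rotates the point of least norm onto the negative real axis.
    obtain ⟨c, hc, hr⟩ := h (-((‖c₀‖⁻¹ : ℝ) : ℂ) * (starRingEnd ℂ) c₀) (by
      rw [norm_mul, norm_neg, Complex.norm_real, RCLike.norm_conj, norm_inv, norm_norm,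
        inv_mul_cancel₀ hn.ne'])
    have h1 := hin c hc
    have h2 : (c₀ * (starRingEnd ℂ) c₀).re = ‖c₀‖ ^ 2 := by
      rw [mul_comm, ← Complex.normSq_eq_conj_mul_self, Complex.ofReal_re, Complex.normSq_eq_norm_sq]
    rw [zero_sub, inner_neg_left, inner_sub_right, Complex.inner, Complex.inner, h2] at h1
    rw [← Complex.ofReal_neg, mul_assoc, Complex.re_ofReal_mul, mul_comm _ c] at hr
    have h3 : ‖c₀‖ ≤ ‖c₀‖⁻¹ * (c * (starRingEnd ℂ) c₀).re := by
      rw [← div_eq_inv_mul, le_div_iff₀ hn]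
      linarith
    linarith

/-- Necessity: approximate Birkhoff orthogonality yields a small support functional value. -/
theorem EpsBirkhoffOrthogonal.exists_isTopFrame_norm_le {T S : E →ₗ[ℂ] F} {k : ℕ} (hk1 : 1 ≤ k)
    (hk : k ≤ finrank ℂ E) {p : ℝ} (hp : 2 ≤ p) {ε : ℝ} (hε : 0 ≤ ε)
    (h : EpsBirkhoffOrthogonal (LinearMap.kyFanNorm p k) ε T S) {M : E →L[ℂ] E}
    (hM : ∀ v : Fin k → E, IsTopFrame T v → ∀ i : Fin k, inner ℂ (v i) (M (v i)) =
      ((T.singularValues i ^ (p - 2) : ℝ) : ℂ) * inner ℂ (T (v i)) (S (v i))) :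
    ∃ v : Fin k → E, IsTopFrame T v ∧
      ‖∑ i, inner ℂ (v i) (M (v i))‖ ≤ T.kyFanNorm p k ^ (p - 1) * (ε * S.kyFanNorm p k) := by
  obtain ⟨v₀, hv₀⟩ := exists_isTopFrame T hk
  have hcpt : IsCompact {c : ℂ | ∃ v : Fin k → E, IsTopFrame T v ∧
      ∑ i, inner ℂ (v i) (M (v i)) = c} :=
    (isCompact_setOf_isTopFrame T k).image
      (f := fun v : Fin k → E => ∑ i, inner ℂ (v i) (M (v i)))
      (by fun_prop)
  obtain ⟨c, ⟨v, hv, rfl⟩, hc⟩ := exists_norm_le_of_convex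
    (W := {c : ℂ | ∃ v : Fin k → E, IsTopFrame T v ∧ ∑ i, inner ℂ (v i) (M (v i)) = c})
    ⟨_, v₀, hv₀, rfl⟩ hcpt
    (convex_setOf_sum_inner_isTopFrame T M hk1)
    (r := T.kyFanNorm p k ^ (p - 1) * (ε * S.kyFanNorm p k))
    (mul_nonneg (Real.rpow_nonneg (T.kyFanNorm_nonneg p k) _)
      (mul_nonneg hε (S.kyFanNorm_nonneg p k))) fun w hw => by
      obtain ⟨v, hv, hc⟩ := exists_isTopFrame_of_kyFanNorm_rpow_ge (T := T) (S := w • S) hk hp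
        (c := T.kyFanNorm p k ^ (p - 1) * (ε * S.kyFanNorm p k)) fun t ht => by
          have h1 := h (t * w)
          rw [LinearMap.kyFanNorm_smul hp hk, norm_mul, hw, mul_one, Complex.norm_real,
            Real.norm_of_nonneg ht.le, mul_smul] at h1
          have hN := T.kyFanNorm_nonneg p k
          have hN' := (T + (t : ℂ) • w • S).kyFanNorm_nonneg p k
          -- The tangent to `x ^ (p / 2)` at `‖T‖ ^ 2` converts the bound on squared norms into one
          -- on p-th powers.
          have h2 := rpow_sub_rpow_le (q := p / 2) (by linarith)
            (sq_nonneg ((T + (t : ℂ) • w • S).kyFanNorm p k)) (sq_nonneg (T.kyFanNorm p k))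
          rw [sq_rpow_eq hN, sq_rpow_eq hN', sq_rpow_eq hN, mul_div_cancel₀ p (two_ne_zero' ℝ),
            show 2 * (p / 2 - 1) = p - 2 by ring] at h2
          have h3 : T.kyFanNorm p k ^ (p - 1) = T.kyFanNorm p k ^ (p - 2) * T.kyFanNorm p k := by
            rw [← Real.rpow_add_one' hN (by linarith)]
            congr 1
            ring
          have h4 : 0 ≤ p / 2 * T.kyFanNorm p k ^ (p - 2) :=
            mul_nonneg (by linarith) (Real.rpow_nonneg hN _)
          have h5 := mul_le_mul_of_nonneg_left
            (show T.kyFanNorm p k ^ 2 - (T + (t : ℂ) • w • S).kyFanNorm p k ^ 2 ≤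
              2 * ε * T.kyFanNorm p k * (t * S.kyFanNorm p k) by linarith) h4
          rw [h3]
          linarith
      refine ⟨_, ⟨v, hv, rfl⟩, hc.trans (le_of_eq ?_)⟩
      rw [Finset.mul_sum]
      refine congrArg Complex.re (Finset.sum_congr rfl fun i _ => ?_)
      rw [hM v hv, LinearMap.smul_apply, inner_smul_right]
      ring
  exact ⟨v, hv, hc⟩

/-- Sufficiency: a small support functional value yields approximate Birkhoff orthogonality. -/
theorem IsTopFrame.epsBirkhoffOrthogonal {T S : E →ₗ[ℂ] F} {k : ℕ} {p : ℝ} (hp : 2 ≤ p) {ε : ℝ}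
    (hε : 0 ≤ ε) {v : Fin k → E} (hv : IsTopFrame T v)
    (h : ‖∑ i : Fin k, ((T.singularValues i ^ (p - 2) : ℝ) : ℂ) * inner ℂ (T (v i)) (S (v i))‖ ≤
      T.kyFanNorm p k ^ (p - 1) * (ε * S.kyFanNorm p k)) :
    EpsBirkhoffOrthogonal (LinearMap.kyFanNorm p k) ε T S := by
  intro z
  have hk : k ≤ finrank ℂ E := by
    simpa using hv.1.linearIndependent.fintype_card_le_finrank
  have hN := T.kyFanNorm_nonneg p k
  rcases hN.eq_or_lt with h0 | hpos
  · rw [← h0]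
    simpa using sq_nonneg _
  have hP : 0 < T.kyFanNorm p k ^ (p - 1) := Real.rpow_pos_of_pos hpos _
  rw [LinearMap.kyFanNorm_smul hp hk]
  set c := ∑ i : Fin k, ((T.singularValues i ^ (p - 2) : ℝ) : ℂ) * inner ℂ (T (v i)) (S (v i))
    with hc
  have h1 := hv.norm_sum_le hp (T + z • S)
  have h2 : ∑ i : Fin k, ((T.singularValues i ^ (p - 2) : ℝ) : ℂ) *
      inner ℂ (T (v i)) ((T + z • S) (v i)) = ((T.kyFanNorm p k ^ p : ℝ) : ℂ) + z * c := by
    rw [← hv.sum_self_eq hp, hc, Finset.mul_sum, ← Finset.sum_add_distrib]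
    refine Finset.sum_congr rfl fun i _ => ?_
    rw [LinearMap.add_apply, LinearMap.smul_apply, inner_add_right, inner_smul_right]
    ring
  have h3 : T.kyFanNorm p k ^ p = T.kyFanNorm p k ^ (p - 1) * T.kyFanNorm p k := by
    rw [← Real.rpow_add_one' hN (by linarith), sub_add_cancel]
  have h4 : T.kyFanNorm p k ^ (p - 1) * (T.kyFanNorm p k - ‖z‖ * (ε * S.kyFanNorm p k)) ≤
      T.kyFanNorm p k ^ (p - 1) * (T + z • S).kyFanNorm p k := by
    rw [h2] at h1
    have h5 := norm_sub_le_norm_add ((T.kyFanNorm p k ^ p : ℝ) : ℂ) (z * c)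
    rw [norm_mul, Complex.norm_real, Real.norm_of_nonneg (Real.rpow_nonneg hN _)] at h5
    have h6 := mul_le_mul_of_nonneg_left h (norm_nonneg z)
    rw [mul_sub, ← h3]
    linarith
  have h7 := le_of_mul_le_mul_left h4 hP
  have hN' := (T + z • S).kyFanNorm_nonneg p k
  have hr : 0 ≤ ‖z‖ * (ε * S.kyFanNorm p k) :=
    mul_nonneg (norm_nonneg _) (mul_nonneg hε (S.kyFanNorm_nonneg p k))
  set r := ‖z‖ * (ε * S.kyFanNorm p k) with hrdef
  have h8 : 2 * ε * T.kyFanNorm p k * (‖z‖ * S.kyFanNorm p k) = 2 * T.kyFanNorm p k * r := by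
    rw [hrdef]
    ring
  rw [h8]
  -- Squaring `‖T‖ - r ≤ ‖T + z S‖` needs `r ≤ ‖T‖`; otherwise the left side of the goal is already
  -- nonpositive.
  rcases le_total r (T.kyFanNorm p k) with h9 | h9
  · nlinarith
  · nlinarith [sq_nonneg ((T + z • S).kyFanNorm p k)]

end Duality

/-! ### Transfer to matrices -/

section Matrix

open Matrix Polynomial

variable {m n k : ℕ}

theorem toEuclideanLin_mul_apply {l : ℕ} (A : Matrix (Fin l) (Fin m) ℂ)
    (B : Matrix (Fin m) (Fin n) ℂ) (v : EuclideanSpace ℂ (Fin n)) :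
    toEuclideanLin (A * B) v = toEuclideanLin A (toEuclideanLin B v) := by
  simp [toLpLin_apply]

theorem toEuclideanLin_aeval_apply {H : Matrix (Fin n) (Fin n) ℂ} {v : EuclideanSpace ℂ (Fin n)}
    {a : ℝ} (hv : toEuclideanLin H v = (a : ℂ) • v) (q : ℝ[X]) :
    toEuclideanLin (aeval H q) v = ((q.eval a : ℝ) : ℂ) • v := by
  induction q using Polynomial.induction_on' with
  | add q r hq hr =>
    rw [map_add, map_add, LinearMap.add_apply, hq, hr, eval_add, Complex.ofReal_add, add_smul]
  | monomial j c =>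
    have hj : toEuclideanLin (H ^ j) v = ((a ^ j : ℝ) : ℂ) • v := by
      induction j with
      | zero => simp
      | succ j ih =>
        rw [pow_succ, toEuclideanLin_mul_apply, hv, map_smul, ih, smul_smul, pow_succ]
        push_cast
        rw [mul_comm]
    rw [aeval_monomial, eval_monomial, ← Algebra.smul_def, ← Complex.coe_smul, map_smul,
      LinearMap.smul_apply, hj, smul_smul, Complex.ofReal_mul]

/-- The functional calculus acts on an eigenvector through the value at the eigenvalue. -/
theorem toEuclideanLin_cfc_apply {H : Matrix (Fin n) (Fin n) ℂ} (hH : H.IsHermitian)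
    {v : EuclideanSpace ℂ (Fin n)} {a : ℝ} (hv : toEuclideanLin H v = (a : ℂ) • v) (f : ℝ → ℝ) :
    toEuclideanLin (cfc f H) v = ((f a : ℝ) : ℂ) • v := by
  classical
  have hfin : (spectrum ℝ H).Finite := Matrix.finite_real_spectrum
  -- The node `a` is added because it may lie outside the spectrum when `v = 0`.
  let s : Finset ℝ := insert a hfin.toFinset
  let q := Lagrange.interpolate s id f
  have hq : ∀ x ∈ s, q.eval x = f x := fun x hx =>
    Lagrange.eval_interpolate_at_node f (Function.injective_id.injOn) hx
  have h1 : cfc f H = cfc (fun x => q.eval x) H :=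
    cfc_congr fun x hx => (hq x (Finset.mem_insert_of_mem (hfin.mem_toFinset.2 hx))).symm
  have h2 : cfc (fun x => q.eval x) H = aeval H q := cfc_polynomial q H hH
  rw [h1, h2, toEuclideanLin_aeval_apply hv, hq a (Finset.mem_insert_self _ _)]

theorem isTopFrame_toEuclideanLin_iff (A : Matrix (Fin m) (Fin n) ℂ)
    (v : Fin k → EuclideanSpace ℂ (Fin n)) :
    IsTopFrame (toEuclideanLin A) v ↔ Orthonormal ℂ v ∧
      ∀ i : Fin k, toEuclideanLin (A.conjTranspose * A) (v i) =
        ((singularValue A i ^ 2 : ℝ) : ℂ) • v i := by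
  simp only [IsTopFrame, toEuclideanLin_mul_apply, toEuclideanLin_conjTranspose_eq_adjoint,
    singularValue]

/-- The Gram power is self-adjoint and scales `v i` by `σ ^ (p - 2)`, so it can be moved to the left
argument, followed by the adjoint of `A`. -/
theorem inner_gramPow_apply (A B : Matrix (Fin m) (Fin n) ℂ) (p : ℝ)
    {v : Fin k → EuclideanSpace ℂ (Fin n)} (hv : IsTopFrame (toEuclideanLin A) v) (i : Fin k) :
    inner ℂ (v i) (toEuclideanLin (gramPow A ((p - 2) / 2) * A.conjTranspose * B) (v i)) =
      (((toEuclideanLin A).singularValues i ^ (p - 2) : ℝ) : ℂ) *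
        inner ℂ (toEuclideanLin A (v i)) (toEuclideanLin B (v i)) := by
  have hG : (gramPow A ((p - 2) / 2)).IsHermitian :=
    cfc_predicate (fun x : ℝ => x ^ ((p - 2) / 2)) (A.conjTranspose * A)
  have hGv := toEuclideanLin_cfc_apply (isHermitian_conjTranspose_mul_self A)
    (((isTopFrame_toEuclideanLin_iff A v).1 hv).2 i) fun x : ℝ => x ^ ((p - 2) / 2)
  rw [toEuclideanLin_mul_apply, toEuclideanLin_mul_apply,
    ← (isSymmetric_toEuclideanLin_iff.2 hG) (v i), gramPow, hGv, inner_smul_left,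
    Complex.conj_ofReal, toEuclideanLin_conjTranspose_eq_adjoint, LinearMap.adjoint_inner_right,
    singularValue, sq_rpow_eq ((toEuclideanLin A).singularValues_nonneg i),
    mul_div_cancel₀ _ (two_ne_zero' ℝ)]

theorem epsBirkhoffOrthogonal_kyFanNorm_iff (A B : Matrix (Fin m) (Fin n) ℂ) (p ε : ℝ) :
    EpsBirkhoffOrthogonal (kyFanNorm p k) ε A B ↔
      EpsBirkhoffOrthogonal (LinearMap.kyFanNorm p k) ε (toEuclideanLin A) (toEuclideanLin B) := by
  refine forall_congr' fun z => ?_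
  rw [← map_smul, ← map_add]
  rfl

end Matrix

theorem mainTheorem7 {m n k : ℕ} (hk : 1 ≤ k) (hkm : k ≤ m) (hkn : k ≤ n)
    (A B : Matrix (Fin m) (Fin n) ℂ) (p : ℝ) (hp : 2 ≤ p)
    (ε : ℝ) (hε0 : 0 ≤ ε) (hε1 : ε < 1) :
    EpsBirkhoffOrthogonal (kyFanNorm p k) ε A B ↔
      ∃ v : Fin k → EuclideanSpace ℂ (Fin n), Orthonormal ℂ v ∧
        (∀ i : Fin k, Matrix.toEuclideanLin (A.conjTranspose * A) (v i) =
          ((singularValue A i ^ 2 : ℝ) : ℂ) • v i) ∧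
        ∃ z₀ : ℂ, ‖z₀‖ ≤ 1 ∧
          ((1 / kyFanNorm p k A ^ (p - 1) : ℝ) : ℂ) *
              ∑ i : Fin k, inner ℂ (v i)
                (Matrix.toEuclideanLin (gramPow A ((p - 2) / 2) * A.conjTranspose * B) (v i)) +
            z₀ * (ε : ℂ) * (kyFanNorm p k B : ℂ) = 0 := by
  have hN : 0 ≤ kyFanNorm p k A := (Matrix.toEuclideanLin A).kyFanNorm_nonneg p k
  have hR : 0 ≤ ε * kyFanNorm p k B :=
    mul_nonneg hε0 ((Matrix.toEuclideanLin B).kyFanNorm_nonneg p k)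
  rw [epsBirkhoffOrthogonal_kyFanNorm_iff]
  constructor
  · intro h
    obtain ⟨v, hv, hc⟩ := h.exists_isTopFrame_norm_le hk (by simpa using hkn) hp hε0
      (M := (Matrix.toEuclideanLin
        (gramPow A ((p - 2) / 2) * A.conjTranspose * B)).toContinuousLinearMap)
      fun v hv i => inner_gramPow_apply A B p hv i
    have hv' := (isTopFrame_toEuclideanLin_iff A v).1 hv
    refine ⟨v, hv'.1, hv'.2, ?_⟩
    change ‖∑ i : Fin k, inner ℂ (v i) (Matrix.toEuclideanLin
      (gramPow A ((p - 2) / 2) * A.conjTranspose * B) (v i))‖ ≤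
      kyFanNorm p k A ^ (p - 1) * (ε * kyFanNorm p k B) at hc
    set c := ∑ i : Fin k, inner ℂ (v i) (Matrix.toEuclideanLin
      (gramPow A ((p - 2) / 2) * A.conjTranspose * B) (v i))
    have hd : ‖((1 / kyFanNorm p k A ^ (p - 1) : ℝ) : ℂ) * c‖ ≤ ε * kyFanNorm p k B := by
      have hP := Real.rpow_nonneg hN (p - 1)
      rw [norm_mul, Complex.norm_real, Real.norm_of_nonneg (by positivity), one_div,
        ← div_eq_inv_mul]
      exact div_le_of_le_mul₀ hP hR (by linarith)
    set d := ((1 / kyFanNorm p k A ^ (p - 1) : ℝ) : ℂ) * c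
    -- If the denominator vanishes, the quotient is 0 and the bound `hd` forces `d = 0`.
    refine ⟨-d / ((ε * kyFanNorm p k B : ℝ) : ℂ), ?_, ?_⟩
    · rw [norm_div, norm_neg, Complex.norm_real, Real.norm_of_nonneg hR]
      exact div_le_one_of_le₀ hd hR
    · rw [mul_assoc, ← Complex.ofReal_mul]
      rcases hR.eq_or_lt with h0 | hpos
      · rw [← h0] at hd ⊢
        simpa using hd
      · rw [div_mul_cancel₀ _ (by exact_mod_cast hpos.ne'), add_neg_cancel]
  · rintro ⟨v, hv1, hv2, z₀, hz₀, h⟩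
    have hv := (isTopFrame_toEuclideanLin_iff A v).2 ⟨hv1, hv2⟩
    -- For `A` of norm 0 the equation carries no information about `B`, but orthogonality is
    -- trivial.
    rcases hN.eq_or_lt with h0 | hpos
    · intro z
      change kyFanNorm p k A ^ 2 - 2 * ε * kyFanNorm p k A * _ ≤ _
      rw [← h0]
      simpa using sq_nonneg _
    refine hv.epsBirkhoffOrthogonal hp hε0 ?_
    simp_rw [← inner_gramPow_apply A B p hv]
    have hP : 0 < kyFanNorm p k A ^ (p - 1) := Real.rpow_pos_of_pos hpos _
    change ‖_‖ ≤ kyFanNorm p k A ^ (p - 1) * (ε * kyFanNorm p k B)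
    rw [mul_assoc, ← Complex.ofReal_mul, add_eq_zero_iff_eq_neg] at h
    have h1 := congrArg norm h
    rw [norm_mul, norm_neg, norm_mul, Complex.norm_real, Complex.norm_real,
      Real.norm_of_nonneg hR, Real.norm_of_nonneg (by positivity), one_div, ← div_eq_inv_mul,
      div_eq_iff hP.ne'] at h1
    rw [h1, mul_comm]
    exact mul_le_mul_of_nonneg_left (mul_le_of_le_one_left hR hz₀) hP.le
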